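/- Let $d\ge 2$ and let $\mathbb V_0^{d+1}=\{(x,t)\in\mathbb R^d\times\mathbb R:\ \|x\|=t,\ 0\le t<\infty\}$ be the surface of the infinite cone. On the ring $\mathbb R[x,t]/\langle \|x\|^2-t^2\rangle$ of polynomials on $\mathbb V_0^{d+1}$ consider the inner product $$\langle f,g\rangle = b\int_{\mathbb V_0^{d+1}} f(x,t)\,g(x,t)\,t^{-1}e^{-t}\,d\sigma(x,t) = b\int_0^\infty\!\int_{\mathbb S^{d-1}} f(t\xi,t)\,g(t\xi,t)\,d\sigma(\xi)\,t^{d-2}e^{-t}\,dt ,$$ where $d\sigma(x,t)=t^{d-1}\,d\sigma(\xi)\,dt$ for $x=t\xi$, $d\sigma(\xi)$ is the surface measure of the unit sphere $\mathbb S^{d-1}$, and $b>0$ is the constant for which $\langle 1,1\rangle=1$. For $n\ge 0$ let $\mathcal V_n$ be the space of orthogonal polynomials of degree $n$: the classes $u$ of polynomials of total degree at most $n$ such that $\langle u,q\rangle=0$ for every polynomial $q$ of degree less than $n$. Then every $u\in\mathcal V_n$ satisfies $$\Big(t\,\partial_t^2+(d-1-t)\,\partial_t+t^{-1}\Delta_0^{(x)}\Big)u=-n\,u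 ,$$ where $u$ is regarded as the function $(\xi,t)\mapsto u(t\xi,t)$ of $\xi\in\mathbb S^{d-1}$ and $t>0$, $\partial_t$ is the derivative in $t$ with $\xi$ fixed, and $\Delta_0^{(x)}$ is the Laplace--Beltrami operator of $\mathbb S^{d-1}$ acting in the variable $\xi$, that is, $\Delta_0 f(\xi)=\Delta\big(f(x/\|x\|)\big)\big|_{x=\xi}$. -/

import Mathlib

namespace ConeSurface

open MeasureTheory Set Metric

noncomputable section

/-- The Euclidean space `ℝ^d`. -/
abbrev E (d : ℕ) : Type := EuclideanSpace ℝ (Fin d)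

/-- The unit sphere `S^{d-1}` of `ℝ^d`. -/
abbrev Sph (d : ℕ) : Type := sphere (0 : E d) 1

/-- Real polynomials in the variables `x = (x_1, …, x_d)` (indexed by `some i`)
and `t` (indexed by `none`). -/
abbrev Poly (d : ℕ) : Type := MvPolynomial (Option (Fin d)) ℝ

/-- The polynomial `‖x‖² - t²`. -/
def conePoly (d : ℕ) : Poly d :=
  (∑ i : Fin d, MvPolynomial.X (some i) ^ 2) - MvPolynomial.X none ^ 2

/-- The ring `ℝ[x,t] / ⟨‖x‖² - t²⟩` of polynomials on the surface of the cone. -/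
abbrev ConeRing (d : ℕ) : Type := Poly d ⧸ Ideal.span {conePoly d}

/-- The value of a polynomial at `(x,t)`. -/
def evalPoly {d : ℕ} (p : E d × ℝ) : Poly d →ₐ[ℝ] ℝ :=
  MvPolynomial.aeval (fun o : Option (Fin d) => o.elim p.2 (fun i => p.1 i))

theorem evalPoly_conePoly {d : ℕ} (p : E d × ℝ) (hp : ‖p.1‖ ^ 2 = p.2 ^ 2) :
    evalPoly p (conePoly d) = 0 := by
  rw [EuclideanSpace.real_norm_sq_eq] at hp
  simp [evalPoly, conePoly, hp]

/-- The value of an element of `ℝ[x,t] / ⟨‖x‖² - t²⟩` at a point `(x,t)` with `‖x‖² = t²`. -/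
def evalCone {d : ℕ} (p : E d × ℝ) (hp : ‖p.1‖ ^ 2 = p.2 ^ 2) : ConeRing d →ₐ[ℝ] ℝ :=
  Ideal.Quotient.liftₐ (Ideal.span {conePoly d}) (evalPoly p) (fun a ha => by
    have h : Ideal.span {conePoly d} ≤ RingHom.ker (evalPoly p) := by
      rw [Ideal.span_singleton_le_iff_mem]
      exact evalPoly_conePoly p hp
    exact h ha)

/-- The surface `V_0^{d+1} = {(x,t) : ‖x‖ = t, 0 ≤ t < ∞}` of the infinite cone. -/
def coneSurface (d : ℕ) : Set (E d × ℝ) := {p | ‖p.1‖ = p.2 ∧ 0 ≤ p.2}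

theorem norm_smul_sphere {d : ℕ} (ξ : Sph d) (t : ℝ) : ‖t • (ξ : E d)‖ ^ 2 = t ^ 2 := by
  simp [norm_smul]

/-- The parametrization `(ξ,t) ↦ (tξ,t)` of the surface of the cone without its apex. -/
def polarPoint {d : ℕ} (q : Sph d × Ioi (0 : ℝ)) : coneSurface d :=
  ⟨((q.2 : ℝ) • (q.1 : E d), (q.2 : ℝ)), by
    have h : (0 : ℝ) < q.2 := q.2.2
    refine ⟨?_, h.le⟩
    simp [norm_smul, abs_of_pos h]⟩

/-- The measure `dσ(x,t)` on the surface of the cone, `dσ(x,t) = t^{d-1} dσ(ξ) dt` for `x = tξ`,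
where `dσ(ξ)` is the surface measure of the unit sphere (`Measure.volumeIoiPow m` is the
measure `t^m dt` on `(0,∞)`). -/
def surfaceMeasure (d : ℕ) : Measure (coneSurface d) :=
  Measure.map polarPoint
    ((volume : Measure (E d)).toSphere.prod (Measure.volumeIoiPow (d - 1)))

/-- The restriction of an element of `ℝ[x,t] / ⟨‖x‖² - t²⟩` to the surface of the cone. -/
def onSurface {d : ℕ} (f : ConeRing d) (p : coneSurface d) : ℝ :=
  evalCone p.1 (by rw [p.2.1]) f

/-- The Laguerre weight `φ_β(t) = t^β e^{-t}`. -/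
def laguerreWeight (β t : ℝ) : ℝ := t ^ β * Real.exp (-t)

/-- The normalization constant, for which `⟨1,1⟩_β = 1`. -/
def normConst (d : ℕ) (β : ℝ) : ℝ :=
  (∫ p, laguerreWeight β p.1.2 ∂(surfaceMeasure d))⁻¹

/-- `⟨f,g⟩_β = b_β ∫ f(x,t) g(x,t) t^β e^{-t} dσ(x,t)` over the surface of the cone. -/
def innerCone {d : ℕ} (β : ℝ) (f g : ConeRing d) : ℝ :=
  normConst d β *
    ∫ p, onSurface f p * onSurface g p * laguerreWeight β p.1.2 ∂(surfaceMeasure d)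

/-- The polynomials of degree at most `n` on the surface of the cone: the classes modulo
`⟨‖x‖² - t²⟩` of the polynomials of total degree at most `n`. -/
def polyDegLE (d n : ℕ) : Set (ConeRing d) :=
  {f | ∃ P : Poly d, P.totalDegree ≤ n ∧ Ideal.Quotient.mk (Ideal.span {conePoly d}) P = f}

/-- `V_n(V_0^{d+1}, φ_β)`: the orthogonal polynomials of degree `n`, that is, the polynomials of
degree at most `n` that are orthogonal to all polynomials of degree less than `n`. -/
def orthoPoly (d : ℕ) (β : ℝ) (n : ℕ) : Set (ConeRing d) :=
  {u | u ∈ polyDegLE d n ∧ ∀ m < n, ∀ q ∈ polyDegLE d m, innerCone β u q = 0}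

/-- The extension `x ↦ f(x/‖x‖)` of a function on the sphere to `ℝ^d` minus the origin
(with the value `0` at the origin). -/
def radialExtension {d : ℕ} (f : Sph d → ℝ) (x : E d) : ℝ :=
  open Classical in
  if h : x ≠ 0 then f ⟨‖x‖⁻¹ • x, by simp [norm_smul, h]⟩ else 0

/-- The Laplace–Beltrami operator `Δ₀` of the unit sphere, the restriction to the sphere of the
Laplace operator of `ℝ^d`: `Δ₀ f (ξ) = Δ (f(x/‖x‖))` at `x = ξ`. -/
def laplaceBeltrami {d : ℕ} (f : Sph d → ℝ) (ξ : Sph d) : ℝ :=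
  Laplacian.laplacian (radialExtension f) (ξ : E d)

/-- `u` as a function of `(ξ,t)`, where `x = tξ`: the value `u(tξ,t)`. -/
def polar {d : ℕ} (u : ConeRing d) (ξ : Sph d) (t : ℝ) : ℝ :=
  evalCone (t • (ξ : E d), t) (norm_smul_sphere ξ t) u

/-- The operator `D_{-1} = t ∂_t² + (d-1-t) ∂_t + t⁻¹ Δ₀`, acting on functions of
`(ξ,t)` with `ξ` in the unit sphere. -/
def diffOp {d : ℕ} (F : Sph d → ℝ → ℝ) (ξ : Sph d) (t : ℝ) : ℝ :=
  t * iteratedDeriv 2 (F ξ) t + ((d : ℝ) - 1 - t) * deriv (F ξ) t +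
    t⁻¹ * laplaceBeltrami (fun η => F η t) ξ

end

end ConeSurface

namespace ConeSurface

open MeasureTheory Set Metric MvPolynomial

noncomputable section

/-! ### Homogeneity and the chain rule for polynomials -/

section Polynomials

variable {σ : Type*} [Fintype σ]

/-! The differential operator is lifted to an operator L = `polyOp` on ℝ[x,t]: the values of L P on
the cone are those of the operator applied to the restriction of P (`diffOp_polar_mk`). Two
properties of L suffice.

L is symmetric for the weight t⁻¹e^{-t} (`coneIntegral_mul_polyOp`): g L f - f L g is a sum of
divergences along the fields t∂_i + x_i∂_t and the Euler field, all tangent to the cone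
(`mul_polyOp_sub`), and each divergence has integral zero (`coneIntegral_tangential`,
`coneIntegral_euler`). By homogeneity these reduce to Γ(s+1) = sΓ(s) and to integration by parts on
the sphere, obtained from Gaussian integrals on ℝ^d (`sphereIntegral_pderiv_rename`).

L does not raise degrees and acts on the part of degree n as -n, up to lower degree
(`polyOp_add_mem_degLT`).

For P representing u, put W = L P + nP, of degree less than n. Then ⟨W,W⟩ = ⟨P, L W + nW⟩ = 0, since
L W + nW also has degree less than n. The inner product is definite on functions on the cone
(`evalPoly_eq_zero_of_coneIntegral`), so W vanishes there. One representative is enough: whether L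
preserves the ideal is never needed. -/

theorem aeval_mul_of_isHomogeneous {P : MvPolynomial σ ℝ} {k : ℕ} (h : P.IsHomogeneous k)
    (t : ℝ) (y : σ → ℝ) : aeval (fun o => t * y o) P = t ^ k * aeval y P := by
  simp only [aeval_def, eval₂_eq', Finset.mul_sum]
  refine Finset.sum_congr rfl fun s hs => ?_
  have hk : ∑ o, s o = k := by
    have := h (mem_support_iff.mp hs)
    simpa [Finsupp.weight_apply, Finsupp.sum_fintype] using this
  simp only [mul_pow, Finset.prod_mul_distrib, Finset.prod_pow_eq_pow_sum, hk]
  ring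

/-- The chain rule for a polynomial along a curve. -/
theorem hasDerivAt_aeval (P : MvPolynomial σ ℝ) {c : ℝ → σ → ℝ} {c' : σ → ℝ} {s : ℝ}
    (hc : ∀ o, HasDerivAt (fun r => c r o) (c' o) s) :
    HasDerivAt (fun r => aeval (c r) P) (∑ o, c' o * aeval (c s) (pderiv o P)) s := by
  classical
  induction P using MvPolynomial.induction_on with
  | C a => simpa using hasDerivAt_const s a
  | add p q hp hq =>
    simp only [map_add, mul_add, Finset.sum_add_distrib]
    exact hp.add hq
  | mul_X p o hp =>
    simp only [map_mul, aeval_X, pderiv_mul, map_add, pderiv_X, mul_add, Finset.sum_add_distrib]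
    convert! hp.mul (hc o) using 1
    rw [Finset.sum_mul]
    congr 1
    · exact Finset.sum_congr rfl fun x _ => by ring
    · rw [Finset.sum_eq_single o]
      · simp [mul_comm]
      · intro b _ hb
        simp [hb.symm]
      · simp

end Polynomials

variable {d : ℕ}

/-! ### Evaluation at points (x,t) -/

theorem evalPoly_X_none (p : E d × ℝ) : evalPoly p (X none) = p.2 := by simp [evalPoly]

theorem evalPoly_X_some (p : E d × ℝ) (i : Fin d) : evalPoly p (X (some i)) = p.1 i := by
  simp [evalPoly]

theorem evalPoly_rename_some (p : E d × ℝ) (Q : MvPolynomial (Fin d) ℝ) :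
    evalPoly p (rename some Q) = aeval p.1 Q := by
  simp only [evalPoly, aeval_rename]
  rfl

theorem evalPoly_smul_of_isHomogeneous {P : Poly d} {k : ℕ} (h : P.IsHomogeneous k)
    (t : ℝ) (x : E d) (s : ℝ) : evalPoly (t • x, t * s) P = t ^ k * evalPoly (x, s) P := by
  rw [evalPoly, evalPoly, ← aeval_mul_of_isHomogeneous h]
  congr 2
  funext o
  cases o <;> simp

theorem continuous_evalPoly (P : Poly d) : Continuous fun p : E d × ℝ => evalPoly p P := by
  induction P using MvPolynomial.induction_on with
  | C a => simpa [evalPoly] using continuous_const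
  | add p q hp hq => simp only [map_add]; exact hp.add hq
  | mul_X p o hp =>
    simp only [map_mul]
    refine hp.mul ?_
    cases o with
    | none => simpa only [evalPoly_X_none] using continuous_snd
    | some i => simp only [evalPoly_X_some]; fun_prop

/-- The chain rule for a polynomial in `(x,t)` along a curve. -/
theorem hasDerivAt_evalPoly (P : Poly d) {c : ℝ → E d} {τ : ℝ → ℝ} {c' : Fin d → ℝ} {τ' s : ℝ}
    (hc : ∀ i, HasDerivAt (fun r => c r i) (c' i) s) (hτ : HasDerivAt τ τ' s) :
    HasDerivAt (fun r => evalPoly (c r, τ r) P)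
      (τ' * evalPoly (c s, τ s) (pderiv none P) +
        ∑ i, c' i * evalPoly (c s, τ s) (pderiv (some i) P)) s := by
  have h := hasDerivAt_aeval P (c := fun r o => o.elim (τ r) (fun i => c r i))
    (c' := fun o => o.elim τ' c') (s := s) (fun o => by cases o <;> simp [hc, hτ])
  simpa [Fintype.sum_option] using! h

/-! ### The lifted operator and its Lagrange identity -/

theorem euler_identity {P : Poly d} {k : ℕ} (h : P.IsHomogeneous k) :
    X none * pderiv none P + ∑ i, X (some i) * pderiv (some i) P = (k : Poly d) * P := by
  have := h.sum_X_mul_pderiv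
  rw [Fintype.sum_option] at this
  simpa using this

/-- The Euler operator. -/
def euler (P : Poly d) : Poly d :=
  X none * pderiv none P + ∑ i, X (some i) * pderiv (some i) P

/-- The operator on `ℝ[x,t]` which acts on the surface of the cone as
`t ∂_t² + (d-1-t) ∂_t + t⁻¹ Δ₀`. -/
def polyOp (P : Poly d) : Poly d :=
  X none * ∑ i, pderiv (some i) (pderiv (some i) P) + X none * pderiv none (pderiv none P) +
    2 * ∑ i, X (some i) * pderiv (some i) (pderiv none P) + ((d : Poly d) - 1) * pderiv none P -
    euler P

theorem pderiv_pderiv_comm {σ : Type*} (i j : σ) (P : MvPolynomial σ ℝ) :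
    pderiv i (pderiv j P) = pderiv j (pderiv i P) := by
  classical
  induction P using MvPolynomial.induction_on with
  | C a => simp
  | add p q hp hq => simp [hp, hq]
  | mul_X p o hp =>
    have hX : ∀ i j : σ, pderiv i (pderiv j (X o : MvPolynomial σ ℝ)) = 0 := fun i j => by
      rcases eq_or_ne o j with rfl | h
      · simp
      · simp [pderiv_X_of_ne h]
    simp only [pderiv_mul, map_add, hp, hX]
    ring

/-- The Lagrange identity: `g L f - f L g` is a divergence. -/
theorem mul_polyOp_sub (f g : Poly d) :
    g * polyOp f - f * polyOp g =
      (∑ i, (X none * pderiv (some i) (g * pderiv (some i) f - f * pderiv (some i) g) +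
        X (some i) * pderiv none (g * pderiv (some i) f - f * pderiv (some i) g) -
        X (some i) * (g * pderiv (some i) f - f * pderiv (some i) g))) +
      (euler (g * pderiv none f - f * pderiv none g) +
        ((d : Poly d) - 1) * (g * pderiv none f - f * pderiv none g) -
        X none * (g * pderiv none f - f * pderiv none g)) := by
  have hop : ∀ P : Poly d, polyOp P = ∑ i, (X none * pderiv (some i) (pderiv (some i) P) +
      2 * (X (some i) * pderiv (some i) (pderiv none P)) - X (some i) * pderiv (some i) P) +
      (X none * pderiv none (pderiv none P) + ((d : Poly d) - 1) * pderiv none P -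
        X none * pderiv none P) := fun P => by
    simp only [polyOp, euler, Finset.sum_add_distrib, Finset.sum_sub_distrib, ← Finset.mul_sum]
    ring
  -- The part Σ x_i∂_i of the Euler field is moved into the tangential sum: only together do the
  -- products of first derivatives cancel, index by index, leaving twice the mixed derivatives.
  have hsum : g * ∑ i, (X none * pderiv (some i) (pderiv (some i) f) +
      2 * (X (some i) * pderiv (some i) (pderiv none f)) - X (some i) * pderiv (some i) f) -
      f * ∑ i, (X none * pderiv (some i) (pderiv (some i) g) +
      2 * (X (some i) * pderiv (some i) (pderiv none g)) - X (some i) * pderiv (some i) g) =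
      (∑ i, (X none * pderiv (some i) (g * pderiv (some i) f - f * pderiv (some i) g) +
        X (some i) * pderiv none (g * pderiv (some i) f - f * pderiv (some i) g) -
        X (some i) * (g * pderiv (some i) f - f * pderiv (some i) g))) +
      ∑ i, X (some i) * pderiv (some i) (g * pderiv none f - f * pderiv none g) := by
    rw [Finset.mul_sum, Finset.mul_sum, ← Finset.sum_sub_distrib, ← Finset.sum_add_distrib]
    refine Finset.sum_congr rfl fun i _ => ?_
    simp only [map_sub, pderiv_mul, pderiv_pderiv_comm none (some i)]
    ring
  rw [hop f, hop g, mul_add, mul_add, euler]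
  have hk : pderiv none (g * pderiv none f - f * pderiv none g) =
      g * pderiv none (pderiv none f) - f * pderiv none (pderiv none g) := by
    simp only [map_sub, pderiv_mul]
    ring
  rw [hk]
  linear_combination hsum

/-! ### Integration in the coordinates (ξ,t) -/

theorem integral_volumeIoiPow (n : ℕ) (g : ℝ → ℝ) :
    ∫ r, g r ∂(Measure.volumeIoiPow n) = ∫ r in Ioi (0 : ℝ), r ^ n * g r := by
  rw [Measure.volumeIoiPow, integral_withDensity_eq_integral_toReal_smul (by fun_prop) (by simp),
    integral_subtype_comap measurableSet_Ioi fun r : ℝ => (ENNReal.ofReal (r ^ n)).toReal • g r]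
  refine setIntegral_congr_fun measurableSet_Ioi fun r hr => ?_
  simp [ENNReal.toReal_ofReal (pow_nonneg (le_of_lt hr) n)]

theorem integrable_volumeIoiPow_iff (n : ℕ) (g : ℝ → ℝ) :
    Integrable (fun r : Ioi (0 : ℝ) => g r) (Measure.volumeIoiPow n) ↔
      IntegrableOn (fun r : ℝ => r ^ n * g r) (Ioi 0) := by
  rw [Measure.volumeIoiPow, integrable_withDensity_iff_integrable_smul' (by fun_prop) (by simp),
    integrableOn_iff_comap_subtypeVal measurableSet_Ioi]
  refine integrable_congr (.of_forall fun r => ?_)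
  simp [ENNReal.toReal_ofReal (pow_nonneg (le_of_lt r.2) n)]

/-- The measure `t^{d-1} dσ(ξ) dt` in the polar coordinates `(ξ,t)`. -/
def polarMeasure (d : ℕ) : Measure (Sph d × Ioi (0 : ℝ)) :=
  (volume : Measure (E d)).toSphere.prod (Measure.volumeIoiPow (d - 1))

/-- The integral of a polynomial over the base `S^{d-1} × {1}` of the cone. -/
def sphereIntegral (P : Poly d) : ℝ :=
  ∫ ξ : Sph d, evalPoly ((ξ : E d), 1) P ∂(volume : Measure (E d)).toSphere

theorem integrable_sphere (P : Poly d) :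
    Integrable (fun ξ : Sph d => evalPoly ((ξ : E d), 1) P)
      (volume : Measure (E d)).toSphere :=
  Continuous.integrable_of_hasCompactSupport
    ((continuous_evalPoly P).comp (by fun_prop)) (HasCompactSupport.of_compactSpace _)

theorem sphereIntegral_natCast_mul (n : ℕ) (P : Poly d) :
    sphereIntegral ((n : Poly d) * P) = n * sphereIntegral P := by
  simp only [sphereIntegral, map_mul, map_natCast]
  exact integral_const_mul _ _

theorem sphereIntegral_X_none_mul (P : Poly d) :
    sphereIntegral (X none * P) = sphereIntegral P := by
  simp [sphereIntegral, evalPoly_X_none]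

theorem sphereIntegral_X_none_pow_mul (n : ℕ) (P : Poly d) :
    sphereIntegral (X none ^ n * P) = sphereIntegral P := by
  simp [sphereIntegral, evalPoly_X_none]

theorem evalPoly_polar {P : Poly d} {k : ℕ} (h : P.IsHomogeneous k) (x : E d) (t : ℝ) :
    evalPoly (t • x, t) P = t ^ k * evalPoly (x, 1) P := by
  simpa using evalPoly_smul_of_isHomogeneous h t x 1

/-- Homogeneity separates the variables, P(tξ,t) = t^k P(ξ,1). It serves both the Gaussian on ℝ^d
and the Laguerre weight on the cone. -/
theorem integral_polar_of_isHomogeneous {P : Poly d} {k : ℕ} (h : P.IsHomogeneous k)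
    (g : ℝ → ℝ) :
    ∫ q, evalPoly ((q.2 : ℝ) • (q.1 : E d), (q.2 : ℝ)) P * g q.2 ∂(polarMeasure d) =
      sphereIntegral P * ∫ r in Ioi (0 : ℝ), r ^ (d - 1) * (r ^ k * g r) := by
  rw [sphereIntegral, ← integral_volumeIoiPow, ← integral_prod_mul]
  refine integral_congr_ae (.of_forall fun q => ?_)
  simp only [evalPoly_polar h]
  ring

theorem integrable_polar_of_isHomogeneous {P : Poly d} {k : ℕ} (h : P.IsHomogeneous k)
    {g : ℝ → ℝ} (hg : IntegrableOn (fun r : ℝ => r ^ (d - 1) * (r ^ k * g r)) (Ioi 0)) :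
    Integrable (fun q : Sph d × Ioi (0 : ℝ) =>
      evalPoly ((q.2 : ℝ) • (q.1 : E d), (q.2 : ℝ)) P * g q.2) (polarMeasure d) := by
  have := (integrable_sphere P).mul_prod ((integrable_volumeIoiPow_iff (d - 1) _).2 hg)
  refine this.congr (.of_forall fun q => ?_)
  simp only [evalPoly_polar h]
  ring

/-! ### Polar coordinates in the Euclidean space -/

theorem measurePreserving_polar (d : ℕ) :
    MeasurePreserving (homeomorphUnitSphereProd (E d))
      (Measure.comap ((↑) : ({0}ᶜ : Set (E d)) → E d) volume)
      (polarMeasure d) := by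
  simpa [polarMeasure] using (volume : Measure (E d)).measurePreserving_homeomorphUnitSphereProd

theorem polar_homeomorph_eq (F : E d → ℝ) (x : ({0}ᶜ : Set (E d))) :
    F (((homeomorphUnitSphereProd (E d) x).2 : ℝ) • ((homeomorphUnitSphereProd (E d) x).1 : E d)) =
      F (x : E d) := by
  have hx : ‖(x : E d)‖ ≠ 0 := norm_ne_zero_iff.2 x.2
  simp [smul_smul, hx]

theorem integral_eq_integral_polar [NeZero d] (F : E d → ℝ) :
    ∫ x, F x = ∫ q, F ((q.2 : ℝ) • (q.1 : E d)) ∂(polarMeasure d) := by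
  rw [← (measurePreserving_polar d).integral_comp (Homeomorph.measurableEmbedding _)
    (fun q => F ((q.2 : ℝ) • (q.1 : E d)))]
  simp only [polar_homeomorph_eq]
  rw [integral_subtype_comap (measurableSet_singleton _).compl, restrict_compl_singleton]

theorem integrable_iff_integrable_polar [NeZero d] (F : E d → ℝ) :
    Integrable F ↔ Integrable (fun q : Sph d × Ioi (0 : ℝ) => F ((q.2 : ℝ) • (q.1 : E d)))
      (polarMeasure d) := by
  rw [← (measurePreserving_polar d).integrable_comp_emb (Homeomorph.measurableEmbedding _)]
  simp only [Function.comp_def, polar_homeomorph_eq]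
  have h : Integrable F ↔ IntegrableOn F {0}ᶜ := by
    rw [IntegrableOn, restrict_compl_singleton]
  rw [h, integrableOn_iff_comap_subtypeVal (measurableSet_singleton _).compl]
  rfl

/-! ### Gaussian integrals and the divergence theorem on the sphere -/

theorem integrableOn_gaussian_moment (m : ℕ) :
    IntegrableOn (fun r : ℝ => r ^ m * Real.exp (-r ^ 2)) (Ioi 0) := by
  have := integrableOn_rpow_mul_exp_neg_rpow (p := 2) (s := m)
    (by have : (0 : ℝ) ≤ m := m.cast_nonneg
        linarith) (by norm_num)
  simpa using this

/-- The moments `∫₀^∞ r^m e^{-r²} dr`. -/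
def gaussianMoment (m : ℕ) : ℝ := ∫ r in Ioi (0 : ℝ), r ^ m * Real.exp (-r ^ 2)

theorem gaussianMoment_eq (m : ℕ) : gaussianMoment m = Real.Gamma (((m : ℝ) + 1) / 2) / 2 := by
  have := integral_rpow_mul_exp_neg_rpow (p := 2) (q := m) (by norm_num)
    (by have : (0 : ℝ) ≤ m := m.cast_nonneg
        linarith)
  simp only [Real.rpow_natCast, Real.rpow_ofNat] at this
  rw [gaussianMoment, this]
  ring

theorem gaussianMoment_pos (m : ℕ) : 0 < gaussianMoment m := by
  rw [gaussianMoment_eq]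
  have := Real.Gamma_pos_of_pos (s := ((m : ℝ) + 1) / 2) (by positivity)
  positivity

/-- The functional equation of Γ; it produces the factor N + d - 1 in
`sphereIntegral_pderiv_rename`. -/
theorem two_mul_gaussianMoment_add_two (m : ℕ) :
    2 * gaussianMoment (m + 2) = (m + 1) * gaussianMoment m := by
  rw [gaussianMoment_eq, gaussianMoment_eq]
  have : ((m + 2 : ℕ) + 1 : ℝ) / 2 = ((m : ℝ) + 1) / 2 + 1 := by push_cast; ring
  rw [this, Real.Gamma_add_one (by positivity)]
  ring

theorem integral_mul_gaussian [NeZero d] {p : MvPolynomial (Fin d) ℝ} {k : ℕ}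
    (h : p.IsHomogeneous k) :
    ∫ x : E d, aeval x p * Real.exp (-‖x‖ ^ 2) =
      sphereIntegral (rename some p) * gaussianMoment (d - 1 + k) := by
  rw [integral_eq_integral_polar]
  have := integral_polar_of_isHomogeneous (h.rename_isHomogeneous (f := some))
    (fun r => Real.exp (-r ^ 2))
  simp only [evalPoly_rename_some, ← mul_assoc, ← pow_add] at this
  simpa [norm_smul, gaussianMoment] using this

theorem integrable_mul_gaussian [NeZero d] {p : MvPolynomial (Fin d) ℝ} {k : ℕ}
    (h : p.IsHomogeneous k) : Integrable fun x : E d => aeval x p * Real.exp (-‖x‖ ^ 2) := by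
  rw [integrable_iff_integrable_polar]
  have := integrable_polar_of_isHomogeneous (h.rename_isHomogeneous (f := some))
    (g := fun r => Real.exp (-r ^ 2))
    (by simpa only [← mul_assoc, ← pow_add] using integrableOn_gaussian_moment _)
  simpa [norm_smul, evalPoly_rename_some] using this

theorem differentiable_aeval (p : MvPolynomial (Fin d) ℝ) :
    Differentiable ℝ fun x : E d => aeval x p := fun x =>
  (AnalyticAt.aeval_mvPolynomial (f := fun x : E d => (x : Fin d → ℝ))
    (fun i => (EuclideanSpace.proj i : E d →L[ℝ] ℝ).analyticAt x) p).differentiableAt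

theorem hasDerivAt_line (x : E d) (i j : Fin d) :
    HasDerivAt (fun s : ℝ => (x + s • EuclideanSpace.single i (1 : ℝ)) j)
      (if j = i then 1 else 0) 0 := by
  have : HasDerivAt (fun s : ℝ => x j + s * (if j = i then 1 else 0))
    (1 * (if j = i then 1 else 0)) 0 := ((hasDerivAt_id (0 : ℝ)).mul_const _).const_add _
  simpa using this

theorem fderiv_aeval_single (p : MvPolynomial (Fin d) ℝ) (x : E d) (i : Fin d) :
    fderiv ℝ (fun x : E d => aeval x p) x (EuclideanSpace.single i 1) =
      aeval x (pderiv i p) := by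
  rw [← (differentiable_aeval p x).lineDeriv_eq_fderiv]
  refine HasLineDerivAt.lineDeriv ?_
  have := hasDerivAt_aeval p (c := fun s => x + s • EuclideanSpace.single i (1 : ℝ))
    (fun j => hasDerivAt_line x i j)
  simpa using! this

theorem fderiv_gaussian_single (x : E d) (i : Fin d) :
    fderiv ℝ (fun x : E d => Real.exp (-‖x‖ ^ 2)) x (EuclideanSpace.single i 1) =
      -2 * x i * Real.exp (-‖x‖ ^ 2) := by
  have : HasFDerivAt (fun x : E d => Real.exp (-‖x‖ ^ 2)) _ x :=
    ((hasStrictFDerivAt_norm_sq x).hasFDerivAt.neg).exp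
  rw [this.fderiv]
  simp [EuclideanSpace.inner_single_right]
  ring

/-- Integration by parts on ℝ^d gives ∫ ∂_i p e^{-‖x‖²} = 2 ∫ x_i p e^{-‖x‖²}. In polar coordinates
both sides are sphere integrals times Gaussian moments, which are then divided out; no calculus on
the sphere is required. -/
theorem sphereIntegral_pderiv_rename {p : MvPolynomial (Fin d) ℝ} {N : ℕ}
    (hd : 1 ≤ d) (h : p.IsHomogeneous N) (i : Fin d) :
    sphereIntegral (rename some (pderiv i p)) =
      (N + d - 1) * sphereIntegral (X (some i) * rename some p) := by
  have : NeZero d := ⟨by omega⟩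
  have hX : (X i * p).IsHomogeneous (1 + N) := (isHomogeneous_X ℝ i).mul h
  have hibp := integral_mul_fderiv_eq_neg_fderiv_mul_of_integrable (μ := (volume : Measure (E d)))
    (f := fun x : E d => aeval x p) (g := fun x => Real.exp (-‖x‖ ^ 2))
    (v := EuclideanSpace.single i (1 : ℝ))
    (by simpa only [fderiv_aeval_single] using integrable_mul_gaussian h.pderiv)
    (by
      simp only [fderiv_gaussian_single]
      refine ((integrable_mul_gaussian hX).const_mul (-2)).congr (.of_forall fun x => ?_)
      simp
      ring)
    (integrable_mul_gaussian h) (fun x _ => differentiable_aeval p x)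
    (fun x _ => (hasStrictFDerivAt_norm_sq x).hasFDerivAt.neg.exp.differentiableAt)
  simp only [fderiv_aeval_single, fderiv_gaussian_single] at hibp
  rw [integral_mul_gaussian h.pderiv] at hibp
  have e : ∫ x : E d, aeval x p * (-2 * x i * Real.exp (-‖x‖ ^ 2)) =
      -2 * ∫ x : E d, aeval x (X i * p) * Real.exp (-‖x‖ ^ 2) := by
    rw [← integral_const_mul]
    refine integral_congr_ae (.of_forall fun x => ?_)
    simp
    ring
  rw [e, integral_mul_gaussian hX, map_mul, rename_X] at hibp
  -- The degree N - 1 of the derivative is truncated at N = 0. There p is constant, and the identity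
  -- says that x_i p has integral zero over the sphere.
  rcases N with _ | N
  · have h0 : pderiv i p = 0 := by
      rw [← totalDegree_zero_iff_isHomogeneous, totalDegree_eq_zero_iff_eq_C] at h
      rw [h, pderiv_C]
    rw [h0] at hibp ⊢
    have h1 := gaussianMoment_pos (d - 1 + (1 + 0))
    have : sphereIntegral (X (some i) * rename some p) = 0 := by
      simpa [sphereIntegral, h1.ne'] using hibp
    rw [this]
    simp [sphereIntegral]
  · have h1 := gaussianMoment_pos (d - 1 + N)
    have h2 := two_mul_gaussianMoment_add_two (d - 1 + N)
    rw [show d - 1 + (1 + (N + 1)) = d - 1 + N + 2 by ring] at hibp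
    rw [show N + 1 - 1 = N from rfl] at hibp
    push_cast [hd] at h2 ⊢
    refine mul_right_cancel₀ h1.ne' ?_
    linear_combination hibp + sphereIntegral (X (some i) * rename some p) * h2

/-! ### The integral over the cone and its divergence theorems -/

/-- The radial density is t^{d-2}e^{-t}; d ≥ 2 keeps the Gamma parameter k + d - 1 positive, hence
the integrals convergent. -/
theorem weight_eq (hd : 2 ≤ d) (k : ℕ) {r : ℝ} (hr : 0 < r) :
    r ^ (d - 1) * (r ^ k * laguerreWeight (-1) r) =
      Real.exp (-r) * r ^ (((k : ℝ) + d - 1) - 1) := by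
  obtain ⟨m, rfl⟩ : ∃ m, d = m + 2 := ⟨d - 2, by omega⟩
  have h1 : ((k : ℝ) + (m + 2 : ℕ) - 1 - 1) = ((k + m : ℕ) : ℝ) := by push_cast; ring
  rw [h1, Real.rpow_natCast, laguerreWeight, Real.rpow_neg_one, show m + 2 - 1 = m + 1 from rfl]
  field_simp
  ring

theorem exponent_pos (hd : 2 ≤ d) (k : ℕ) : (0 : ℝ) < (k : ℝ) + d - 1 := by
  have h1 : (2 : ℝ) ≤ d := by exact_mod_cast hd
  have h2 : (0 : ℝ) ≤ k := k.cast_nonneg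
  linarith

theorem integrableOn_weight (hd : 2 ≤ d) (k : ℕ) :
    IntegrableOn (fun r : ℝ => r ^ (d - 1) * (r ^ k * laguerreWeight (-1) r)) (Ioi 0) :=
  (Real.GammaIntegral_convergent (exponent_pos hd k)).congr_fun
    (fun _ hr => (weight_eq hd k hr).symm) measurableSet_Ioi

theorem integral_weight (hd : 2 ≤ d) (k : ℕ) :
    ∫ r in Ioi (0 : ℝ), r ^ (d - 1) * (r ^ k * laguerreWeight (-1) r) =
      Real.Gamma ((k : ℝ) + d - 1) := by
  rw [Real.Gamma_eq_integral (exponent_pos hd k)]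
  exact setIntegral_congr_fun measurableSet_Ioi fun _ hr => weight_eq hd k hr

theorem integrable_polar (hd : 2 ≤ d) (P : Poly d) :
    Integrable (fun q : Sph d × Ioi (0 : ℝ) =>
      evalPoly ((q.2 : ℝ) • (q.1 : E d), (q.2 : ℝ)) P * laguerreWeight (-1) q.2)
      (polarMeasure d) := by
  induction P using MvPolynomial.induction_on' with
  | monomial s c =>
    exact integrable_polar_of_isHomogeneous (isHomogeneous_monomial c rfl)
      (integrableOn_weight hd _)
  | add p q hp hq =>
    simp only [map_add, add_mul]
    exact hp.add hq

/-- The integral of a polynomial over the surface of the cone, against `t⁻¹ e^{-t} dσ(x,t)`. -/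
def coneIntegral (hd : 2 ≤ d) : Poly d →ₗ[ℝ] ℝ where
  toFun P := ∫ q, evalPoly ((q.2 : ℝ) • (q.1 : E d), (q.2 : ℝ)) P * laguerreWeight (-1) q.2
    ∂(polarMeasure d)
  map_add' P Q := by
    simp only [map_add, add_mul]
    exact integral_add (integrable_polar hd P) (integrable_polar hd Q)
  map_smul' c P := by
    simp only [map_smul, smul_eq_mul, mul_assoc, RingHom.id_apply]
    exact integral_const_mul _ _

theorem coneIntegral_of_isHomogeneous (hd : 2 ≤ d) {P : Poly d} {k : ℕ} (h : P.IsHomogeneous k) :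
    coneIntegral hd P = Real.Gamma ((k : ℝ) + d - 1) * sphereIntegral P := by
  have := integral_polar_of_isHomogeneous h (laguerreWeight (-1))
  rw [integral_weight hd, mul_comm] at this
  exact this

theorem isHomogeneous_X_mul_pderiv {σ : Type*} {P : MvPolynomial σ ℝ} {k : ℕ}
    (h : P.IsHomogeneous k) (o o' : σ) : (X o * pderiv o' P).IsHomogeneous k := by
  rcases k with _ | k
  · rw [← totalDegree_zero_iff_isHomogeneous, totalDegree_eq_zero_iff_eq_C] at h
    rw [h, pderiv_C, mul_zero]
    exact isHomogeneous_zero _ _ _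
  · simpa [add_comm] using (isHomogeneous_X ℝ o).mul h.pderiv

theorem monomial_eq_X_none_pow_mul (s : Option (Fin d) →₀ ℕ) (c : ℝ) :
    (monomial s c : Poly d) = X none ^ s none * rename some (monomial s.some c) := by
  rw [rename_monomial, X_pow_eq_monomial, monomial_mul, one_mul]
  refine congrArg (fun m => monomial m c) (Finsupp.ext fun o => ?_)
  cases o with
  | none => simp [Finsupp.mapDomain_of_notMem_range]
  | some i => simp [Finsupp.mapDomain_apply (Option.some_injective _)]

theorem pderiv_none_rename_some (p : MvPolynomial (Fin d) ℝ) :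
    pderiv none (rename some p : Poly d) = 0 := by
  induction p using MvPolynomial.induction_on with
  | C a => simp
  | add p q hp hq => simp [hp, hq]
  | mul_X p i hp => simp [hp]

theorem sphereIntegral_X_mul_pow (i : Fin d) (l : ℕ) (P : Poly d) :
    sphereIntegral (X (some i) * (X none ^ l * P)) = sphereIntegral (X (some i) * P) := by
  simp [sphereIntegral, evalPoly_X_none]

/-- For t^l p(x) with deg p = N and k = l + N, all three sphere integrals are multiples of ∫ x_i p,
with factors N + d - 1, l and 1. The first two carry the radial factor Γ(k+d-1), the third Γ(k+d),
and (k+d-1)Γ(k+d-1) = Γ(k+d). -/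
theorem coneIntegral_tangential_monomial (hd : 2 ≤ d) (i : Fin d) (s : Option (Fin d) →₀ ℕ)
    (c : ℝ) :
    coneIntegral hd (X none * pderiv (some i) (monomial s c) +
      X (some i) * pderiv none (monomial s c) - X (some i) * monomial s c) = 0 := by
  set N := s.some.degree
  set l := s none
  have hp : (monomial s.some c : MvPolynomial (Fin d) ℝ).IsHomogeneous N :=
    isHomogeneous_monomial c rfl
  have hh : (monomial s c : Poly d).IsHomogeneous (l + N) := by
    rw [monomial_eq_X_none_pow_mul]
    exact (isHomogeneous_X_pow none l).mul hp.rename_isHomogeneous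
  set p := (monomial s.some c : MvPolynomial (Fin d) ℝ)
  have hA : sphereIntegral (X none * pderiv (some i) (monomial s c)) =
      ((N : ℝ) + d - 1) * sphereIntegral (X (some i) * rename some p) := by
    rw [sphereIntegral_X_none_mul, monomial_eq_X_none_pow_mul, pderiv_mul, pderiv_pow,
      pderiv_X_of_ne (by simp), pderiv_rename (Option.some_injective _)]
    simp only [mul_zero, zero_mul, zero_add]
    rw [sphereIntegral_X_none_pow_mul, sphereIntegral_pderiv_rename (by omega) hp]
  have hB : sphereIntegral (X (some i) * pderiv none (monomial s c)) =
      l * sphereIntegral (X (some i) * rename some p) := by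
    rw [monomial_eq_X_none_pow_mul, pderiv_mul, pderiv_pow, pderiv_X_self,
      pderiv_none_rename_some]
    simp only [mul_zero, add_zero, mul_one]
    rw [mul_assoc, mul_left_comm, sphereIntegral_natCast_mul, sphereIntegral_X_mul_pow]
  have hC : sphereIntegral (X (some i) * monomial s c) =
      sphereIntegral (X (some i) * rename some p) := by
    rw [monomial_eq_X_none_pow_mul, sphereIntegral_X_mul_pow]
  rw [map_sub, map_add, coneIntegral_of_isHomogeneous hd (isHomogeneous_X_mul_pderiv hh _ _),
    coneIntegral_of_isHomogeneous hd (isHomogeneous_X_mul_pderiv hh _ _),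
    coneIntegral_of_isHomogeneous hd ((isHomogeneous_X ℝ (some i)).mul hh), hA, hB, hC]
  have e : ((1 + (l + N) : ℕ) : ℝ) + d - 1 = (((l + N : ℕ) : ℝ) + d - 1) + 1 := by
    push_cast; ring
  rw [e, Real.Gamma_add_one (exponent_pos hd _).ne']
  push_cast
  ring

/-- The divergence theorem for the tangential derivatives `t ∂_i + x_i ∂_t` of the cone. -/
theorem coneIntegral_tangential (hd : 2 ≤ d) (i : Fin d) (h : Poly d) :
    coneIntegral hd (X none * pderiv (some i) h + X (some i) * pderiv none h - X (some i) * h) =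
      0 := by
  induction h using MvPolynomial.induction_on' with
  | monomial s c => exact coneIntegral_tangential_monomial hd i s c
  | add p q hp hq =>
    -- The right side becomes 0 + 0 and each zero is replaced by an induction hypothesis, leaving an
    -- identity of polynomials.
    rw [← add_zero (0 : ℝ)]
    nth_rw 1 [← hp]
    rw [← hq, ← map_add]
    congr 1
    simp only [map_add]
    ring

/-- The divergence theorem for the radial derivative of the cone. -/
theorem coneIntegral_euler (hd : 2 ≤ d) (h : Poly d) :
    coneIntegral hd (euler h + ((d : Poly d) - 1) * h - X none * h) = 0 := by
  induction h using MvPolynomial.induction_on' with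
  | monomial s c =>
    have hh : (monomial s c : Poly d).IsHomogeneous s.degree := isHomogeneous_monomial c rfl
    -- By Euler's identity the first-order part is multiplication by k + d - 1, so again Γ(s+1) =
    -- sΓ(s) closes the case.
    have e1 : euler (monomial s c : Poly d) + ((d : Poly d) - 1) * monomial s c =
        ((s.degree : ℝ) + d - 1) • monomial s c := by
      rw [euler, euler_identity hh, MvPolynomial.smul_eq_C_mul]
      simp only [map_sub, map_add, map_natCast, map_one]
      ring
    rw [e1, map_sub, map_smul, coneIntegral_of_isHomogeneous hd hh,
      coneIntegral_of_isHomogeneous hd ((isHomogeneous_X ℝ none).mul hh),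
      sphereIntegral_X_none_mul]
    have e : ((1 + s.degree : ℕ) : ℝ) + d - 1 = ((s.degree : ℝ) + d - 1) + 1 := by
      push_cast; ring
    rw [e, Real.Gamma_add_one (exponent_pos hd _).ne', smul_eq_mul]
    ring
  | add p q hp hq =>
    rw [← add_zero (0 : ℝ)]
    nth_rw 1 [← hp]
    rw [← hq, ← map_add]
    congr 1
    simp only [euler, map_add, mul_add, Finset.sum_add_distrib]
    ring

/-- The operator is symmetric for the inner product on the surface of the cone. -/
theorem coneIntegral_mul_polyOp (hd : 2 ≤ d) (f g : Poly d) :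
    coneIntegral hd (g * polyOp f) = coneIntegral hd (f * polyOp g) := by
  rw [← sub_eq_zero, ← map_sub, mul_polyOp_sub, map_add, map_sum, coneIntegral_euler, add_zero]
  exact Finset.sum_eq_zero fun i _ => coneIntegral_tangential hd i _

/-! ### Degrees -/

/-- The polynomials of total degree less than `n`. -/
def degLT (d n : ℕ) : Submodule ℝ (Poly d) := restrictSupport ℝ {s | s.degree < n}

theorem mem_degLT {n : ℕ} {P : Poly d} : P ∈ degLT d n ↔ ∀ s ∈ P.support, s.degree < n :=
  mem_restrictSupport_iff _

theorem mem_degLT_of_isHomogeneous {n k : ℕ} {P : Poly d} (h : P.IsHomogeneous k) (hk : k < n) :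
    P ∈ degLT d n := mem_degLT.2 fun s hs => by
  rw [Finsupp.degree_eq_weight_one]
  exact (h (mem_support_iff.1 hs)).trans_lt hk

theorem mem_degLT_X_mul_pderiv_pderiv {n k : ℕ} {P : Poly d} (h : P.IsHomogeneous k)
    (hk : k ≤ n) (o o' o'' : Option (Fin d)) : X o * pderiv o' (pderiv o'' P) ∈ degLT d n := by
  rcases k with _ | k
  · rw [← totalDegree_zero_iff_isHomogeneous, totalDegree_eq_zero_iff_eq_C] at h
    rw [h, pderiv_C, map_zero, mul_zero]
    exact zero_mem _
  · exact mem_degLT_of_isHomogeneous (isHomogeneous_X_mul_pderiv (k := k) h.pderiv o o') hk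

theorem mem_degLT_pderiv {n k : ℕ} {P : Poly d} (h : P.IsHomogeneous k)
    (hk : k ≤ n) (o : Option (Fin d)) : pderiv o P ∈ degLT d n := by
  rcases k with _ | k
  · rw [← totalDegree_zero_iff_isHomogeneous, totalDegree_eq_zero_iff_eq_C] at h
    rw [h, pderiv_C]
    exact zero_mem _
  · exact mem_degLT_of_isHomogeneous (k := k) h.pderiv hk

theorem natCast_mul_mem_degLT {n : ℕ} {P : Poly d} (h : P ∈ degLT d n) (m : ℕ) :
    (m : Poly d) * P ∈ degLT d n := by
  rw [← nsmul_eq_mul]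
  exact nsmul_mem h m

/-- Every term of the operator lowers the degree by one except minus the Euler operator, which acts
as -k. What remains in degree k is (n - k)P, which vanishes when k = n. -/
theorem polyOp_add_mem_of_isHomogeneous {n k : ℕ} {P : Poly d} (h : P.IsHomogeneous k)
    (hk : k ≤ n) : polyOp P + (n : Poly d) * P ∈ degLT d n := by
  have e : polyOp P + (n : Poly d) * P =
      (∑ i, X none * pderiv (some i) (pderiv (some i) P)) + X none * pderiv none (pderiv none P) +
      ((2 : ℕ) : Poly d) * (∑ i, X (some i) * pderiv (some i) (pderiv none P)) +
      ((d : Poly d) * pderiv none P - pderiv none P) + ((n - k : ℕ) : Poly d) * P := by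
    rw [polyOp, euler, euler_identity h, Nat.cast_sub hk, Finset.mul_sum]
    push_cast
    ring
  rw [e]
  refine add_mem (add_mem (add_mem (add_mem ?_ ?_) ?_) ?_) ?_
  · exact sum_mem fun i _ => mem_degLT_X_mul_pderiv_pderiv h hk _ _ _
  · exact mem_degLT_X_mul_pderiv_pderiv h hk _ _ _
  · exact natCast_mul_mem_degLT (sum_mem fun i _ => mem_degLT_X_mul_pderiv_pderiv h hk _ _ _) _
  · exact sub_mem (natCast_mul_mem_degLT (mem_degLT_pderiv h hk _) _) (mem_degLT_pderiv h hk _)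
  · rcases hk.eq_or_lt with rfl | hlt
    · simp
    · exact natCast_mul_mem_degLT (mem_degLT_of_isHomogeneous h hlt) _

/-- The operator as a linear map. -/
def polyOpLinear (d : ℕ) : Poly d →ₗ[ℝ] Poly d where
  toFun := polyOp
  map_add' P Q := by
    simp only [polyOp, euler, map_add, mul_add, Finset.sum_add_distrib]
    ring
  map_smul' c P := by
    simp only [polyOp, euler, Derivation.map_smul, mul_smul_comm, ← Finset.smul_sum, ← smul_add, ← smul_sub,
      RingHom.id_apply]

theorem polyOp_add_mem_degLT {n : ℕ} {P : Poly d} (hP : P.totalDegree ≤ n) :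
    polyOp P + (n : Poly d) * P ∈ degLT d n := by
  have e : polyOp P + (n : Poly d) * P =
      ∑ k ∈ Finset.range (P.totalDegree + 1), (polyOp (homogeneousComponent k P) +
        (n : Poly d) * homogeneousComponent k P) := by
    rw [Finset.sum_add_distrib, ← Finset.mul_sum, sum_homogeneousComponent]
    congr 1
    change polyOpLinear d P = ∑ k ∈ _, polyOpLinear d _
    rw [← map_sum, sum_homogeneousComponent]
  rw [e]
  refine sum_mem fun k hk => polyOp_add_mem_of_isHomogeneous
    (homogeneousComponent_isHomogeneous k P) ?_
  have := Finset.mem_range.1 hk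
  omega

/-! ### The differential operator in polar coordinates -/

theorem evalPoly_C (p : E d × ℝ) (c : ℝ) : evalPoly p (C c) = c := by simp [evalPoly]

theorem hasDerivAt_evalPoly_ray (ξ : E d) (P : Poly d) (s : ℝ) :
    HasDerivAt (fun s => evalPoly (s • ξ, s) P)
      (evalPoly (s • ξ, s) (pderiv none P + ∑ i, C (ξ i) * pderiv (some i) P)) s := by
  have := hasDerivAt_evalPoly P (c := fun s => s • ξ) (τ := id) (c' := fun i => ξ i) (s := s)
    (fun i => by simpa using (hasDerivAt_id s).mul_const (ξ i)) (hasDerivAt_id s)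
  simpa [evalPoly_C] using! this

/-- The derivative of a polynomial along `x_i` after restriction to the sphere of radius `t`. -/
def sphericalDeriv (t : ℝ) (i : Fin d) (P : Poly d) : Poly d :=
  C t * pderiv (some i) P - C t⁻¹ * (X (some i) * ∑ j, X (some j) * pderiv (some j) P)

/-- Differentiating along (t/‖x‖)x gives ‖x‖⁻¹ times a function of the same kind, with
`sphericalDeriv t i P` in place of P, so the computation can be iterated for second derivatives. -/
theorem hasLineDerivAt_evalPoly_radial {t : ℝ} (ht : 0 < t) (P : Poly d) {x : E d} (hx : x ≠ 0)
    (i : Fin d) :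
    HasLineDerivAt ℝ (fun x : E d => evalPoly ((t * ‖x‖⁻¹) • x, t) P)
      (‖x‖⁻¹ * evalPoly ((t * ‖x‖⁻¹) • x, t) (sphericalDeriv t i P)) x
      (EuclideanSpace.single i 1) := by
  have hx0 : ‖x‖ ≠ 0 := norm_ne_zero_iff.2 hx
  have hline : HasDerivAt (fun s : ℝ => x + s • EuclideanSpace.single i (1 : ℝ))
      (EuclideanSpace.single i (1 : ℝ)) 0 := by
    simpa using ((hasDerivAt_id (0 : ℝ)).smul_const (EuclideanSpace.single i (1 : ℝ))).const_add x
  have hnorm : HasDerivAt (fun s : ℝ => ‖x + s • EuclideanSpace.single i (1 : ℝ)‖⁻¹)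
      (-(x i / ‖x‖) / ‖x‖ ^ 2) 0 := by
    have h1 := hline.norm_sq.sqrt (by simpa using hx0)
    simp only [Real.sqrt_sq (norm_nonneg _)] at h1
    have h2 := h1.inv (by simpa using hx0)
    convert! h2 using 1
    simp [EuclideanSpace.inner_single_right]
    ring
  have hc : ∀ j, HasDerivAt (fun s : ℝ =>
      ((t * ‖x + s • EuclideanSpace.single i (1 : ℝ)‖⁻¹) •
        (x + s • EuclideanSpace.single i (1 : ℝ))) j)
      (t * (-(x i / ‖x‖) / ‖x‖ ^ 2) * x j + t * ‖x‖⁻¹ * (if j = i then 1 else 0)) 0 := fun j => by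
    convert! (hnorm.const_mul t).mul (hasDerivAt_line x i j) using 1
    simp
  have := hasDerivAt_evalPoly P (τ := fun _ => t) hc (hasDerivAt_const 0 t)
  rw [HasLineDerivAt]
  convert! this using 1
  simp only [zero_smul, add_zero, zero_mul, zero_add, add_mul, Finset.sum_add_distrib,
    mul_ite, mul_one, mul_zero, ite_mul, Finset.sum_ite_eq', Finset.mem_univ, if_true,
    sphericalDeriv, map_sub, map_mul, map_sum, evalPoly_C, evalPoly_X_some, PiLp.smul_apply,
    smul_eq_mul]
  simp only [mul_assoc, ← Finset.mul_sum]
  field_simp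
  ring

theorem contDiffAt_evalPoly_radial (t : ℝ) (P : Poly d) {x : E d} (hx : x ≠ 0) :
    ContDiffAt ℝ 2 (fun x : E d => evalPoly ((t * ‖x‖⁻¹) • x, t) P) x := by
  induction P using MvPolynomial.induction_on with
  | C a => simpa only [evalPoly_C] using contDiffAt_const
  | add p q hp hq => simp only [map_add]; exact hp.add hq
  | mul_X p o hp =>
    simp only [map_mul]
    refine hp.mul ?_
    cases o with
    | none => simpa only [evalPoly_X_none] using contDiffAt_const
    | some i =>
      simp only [evalPoly_X_some, PiLp.smul_apply, smul_eq_mul]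
      exact (contDiffAt_const.mul ((contDiffAt_norm ℝ hx).inv (norm_ne_zero_iff.2 hx))).mul
        (EuclideanSpace.proj i : E d →L[ℝ] ℝ).contDiff.contDiffAt

theorem fderiv_evalPoly_radial {t : ℝ} (ht : 0 < t) (P : Poly d) {x : E d} (hx : x ≠ 0)
    (i : Fin d) :
    fderiv ℝ (fun x : E d => evalPoly ((t * ‖x‖⁻¹) • x, t) P) x (EuclideanSpace.single i 1) =
      ‖x‖⁻¹ * evalPoly ((t * ‖x‖⁻¹) • x, t) (sphericalDeriv t i P) := by
  rw [← ((contDiffAt_evalPoly_radial t P hx).differentiableAt (by norm_num)).lineDeriv_eq_fderiv]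
  exact (hasLineDerivAt_evalPoly_radial ht P hx i).lineDeriv

theorem fderiv_norm_inv_single (ξ : Sph d) (i : Fin d) :
    fderiv ℝ (fun x : E d => ‖x‖⁻¹) ξ (EuclideanSpace.single i 1) = -(ξ : E d) i := by
  have hξ : ‖(ξ : E d)‖ = 1 := norm_eq_of_mem_sphere ξ
  have h0 : (ξ : E d) ≠ 0 := by rw [← norm_ne_zero_iff, hξ]; exact one_ne_zero
  have h1 : HasFDerivAt (fun x : E d => √(‖x‖ ^ 2)) _ (ξ : E d) :=
    (hasStrictFDerivAt_norm_sq (ξ : E d)).hasFDerivAt.sqrt (by simp [hξ])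
  simp only [Real.sqrt_sq (norm_nonneg _)] at h1
  have h2 : HasFDerivAt (fun x : E d => ‖x‖⁻¹) _ (ξ : E d) :=
    (hasDerivAt_inv (by rw [hξ]; exact one_ne_zero)).comp_hasFDerivAt (ξ : E d) h1
  rw [h2.fderiv]
  simp [hξ, EuclideanSpace.inner_single_right]

/-- The first-order formula is applied twice; the summand with -ξ_i comes from differentiating the
factor ‖x‖⁻¹ at a unit vector. -/
theorem laplaceBeltrami_evalPoly_eq_sum {t : ℝ} (ht : 0 < t) (P : Poly d) (ξ : Sph d) :
    laplaceBeltrami (fun η : Sph d => evalPoly (t • (η : E d), t) P) ξ =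
      ∑ i, (-(ξ : E d) i * evalPoly (t • (ξ : E d), t) (sphericalDeriv t i P) +
        evalPoly (t • (ξ : E d), t) (sphericalDeriv t i (sphericalDeriv t i P))) := by
  have hξ : ‖(ξ : E d)‖ = 1 := norm_eq_of_mem_sphere ξ
  have h0 : (ξ : E d) ≠ 0 := by rw [← norm_ne_zero_iff, hξ]; exact one_ne_zero
  have hne : ∀ᶠ x : E d in nhds (ξ : E d), x ≠ 0 := isOpen_ne.mem_nhds h0
  have hev : radialExtension (fun η : Sph d => evalPoly (t • (η : E d), t) P) =ᶠ[nhds (ξ : E d)]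
      fun x : E d => evalPoly ((t * ‖x‖⁻¹) • x, t) P := by
    filter_upwards [hne] with x hx
    simp [radialExtension, hx, smul_smul]
  rw [laplaceBeltrami, (InnerProductSpace.laplacian_congr_nhds hev).eq_of_nhds,
    InnerProductSpace.laplacian_eq_iteratedFDeriv_orthonormalBasis _
      (EuclideanSpace.basisFun (Fin d) ℝ)]
  refine Finset.sum_congr rfl fun i _ => ?_
  rw [iteratedFDeriv_two_apply]
  simp only [EuclideanSpace.basisFun_apply, Matrix.cons_val_zero, Matrix.cons_val_one]
  have hdf : DifferentiableAt ℝ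
      (fderiv ℝ (fun x : E d => evalPoly ((t * ‖x‖⁻¹) • x, t) P)) (ξ : E d) :=
    ((contDiffAt_evalPoly_radial t P h0).fderiv_right (m := 1) (by norm_num)).differentiableAt
      (by norm_num)
  have h1 : fderiv ℝ (fun x => fderiv ℝ (fun x : E d => evalPoly ((t * ‖x‖⁻¹) • x, t) P) x
      (EuclideanSpace.single i 1)) (ξ : E d) (EuclideanSpace.single i 1) =
      fderiv ℝ (fderiv ℝ (fun x : E d => evalPoly ((t * ‖x‖⁻¹) • x, t) P)) (ξ : E d)
        (EuclideanSpace.single i 1) (EuclideanSpace.single i 1) := by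
    rw [fderiv_clm_apply hdf (differentiableAt_const _)]
    simp
  have hev1 : (fun x => fderiv ℝ (fun x : E d => evalPoly ((t * ‖x‖⁻¹) • x, t) P) x
      (EuclideanSpace.single i 1)) =ᶠ[nhds (ξ : E d)]
      fun x => ‖x‖⁻¹ * evalPoly ((t * ‖x‖⁻¹) • x, t) (sphericalDeriv t i P) := by
    filter_upwards [hne] with x hx using fderiv_evalPoly_radial ht P hx i
  have hinv : DifferentiableAt ℝ (fun x : E d => ‖x‖⁻¹) (ξ : E d) :=
    ((contDiffAt_norm ℝ h0).inv (norm_ne_zero_iff.2 h0)).differentiableAt (n := 1) (by norm_num)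
  rw [← h1, hev1.fderiv_eq, fderiv_fun_mul
    hinv
    ((contDiffAt_evalPoly_radial t _ h0).differentiableAt (by norm_num))]
  simp only [add_apply, smul_apply, smul_eq_mul,
    fderiv_evalPoly_radial ht _ h0, fderiv_norm_inv_single, hξ]
  simp
  ring

theorem sum_sq_sphere (ξ : Sph d) : ∑ i, (ξ : E d) i ^ 2 = 1 := by
  have hξ : ‖(ξ : E d)‖ = 1 := norm_eq_of_mem_sphere ξ
  rw [← EuclideanSpace.real_norm_sq_eq, hξ, one_pow]

theorem evalPoly_sphericalDeriv {t : ℝ} (ht : 0 < t) (P : Poly d) (x : E d) (i : Fin d) :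
    evalPoly (t • x, t) (sphericalDeriv t i P) =
      t * evalPoly (t • x, t) (pderiv (some i) P) -
        t * x i * ∑ j, x j * evalPoly (t • x, t) (pderiv (some j) P) := by
  simp only [sphericalDeriv, map_sub, map_mul, map_sum, evalPoly_C, evalPoly_X_some,
    PiLp.smul_apply, smul_eq_mul, mul_assoc, ← Finset.mul_sum]
  field_simp

theorem evalPoly_pderiv_sphericalDeriv {t : ℝ} (ht : 0 < t) (P : Poly d) (x : E d)
    (i j : Fin d) :
    evalPoly (t • x, t) (pderiv (some j) (sphericalDeriv t i P)) =
      t * evalPoly (t • x, t) (pderiv (some j) (pderiv (some i) P)) -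
        (if j = i then 1 else 0) * ∑ k, x k * evalPoly (t • x, t) (pderiv (some k) P) -
        x i * evalPoly (t • x, t) (pderiv (some j) P) -
        t * x i * ∑ k, x k * evalPoly (t • x, t) (pderiv (some k) (pderiv (some j) P)) := by
  have hX : ∀ k : Fin d, evalPoly (t • x, t) (pderiv (some j) (X (some k) : Poly d)) =
      if k = j then 1 else 0 := fun k => by
    by_cases h : k = j
    · simp [h]
    · simp [pderiv_X_of_ne (show (some k : Option (Fin d)) ≠ some j by simpa using h), h]
  simp only [sphericalDeriv, map_sub, map_sum, pderiv_mul, pderiv_C, zero_mul, zero_add,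
    map_mul, map_add, evalPoly_C, evalPoly_X_some, hX, PiLp.smul_apply, smul_eq_mul, ite_mul,
    one_mul, Finset.sum_add_distrib, Finset.sum_ite_eq', Finset.mem_univ, if_true,
    pderiv_pderiv_comm (some j) (some _) P, mul_assoc, ← Finset.mul_sum, @eq_comm _ j i]
  split_ifs <;> field_simp <;> ring

/-- This is Δ₀ = t²(Δ - (d-1)t⁻¹∂_r - ∂_r²) on the sphere of radius t, where ∂_r = ξ·∇_x. -/
theorem laplaceBeltrami_evalPoly {t : ℝ} (ht : 0 < t) (P : Poly d) (ξ : Sph d) :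
    laplaceBeltrami (fun η : Sph d => evalPoly (t • (η : E d), t) P) ξ =
      t ^ 2 * ∑ i, evalPoly (t • (ξ : E d), t) (pderiv (some i) (pderiv (some i) P)) -
      (d - 1) * t * ∑ i, (ξ : E d) i * evalPoly (t • (ξ : E d), t) (pderiv (some i) P) -
      t ^ 2 * ∑ i, (ξ : E d) i * ∑ j, (ξ : E d) j *
        evalPoly (t • (ξ : E d), t) (pderiv (some j) (pderiv (some i) P)) := by
  rw [laplaceBeltrami_evalPoly_eq_sum ht]
  set x : E d := (ξ : E d)
  have hsq : ∑ i, x i ^ 2 = 1 := sum_sq_sphere ξ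
  set a : Fin d → ℝ := fun i => evalPoly (t • x, t) (pderiv (some i) P) with ha
  set b : Fin d → Fin d → ℝ := fun j i =>
    evalPoly (t • x, t) (pderiv (some j) (pderiv (some i) P)) with hb
  set S : ℝ := ∑ i, x i * a i with hS
  set β : Fin d → ℝ := fun i => ∑ j, x j * b j i with hβ
  set γ : ℝ := ∑ i, x i * β i with hγ
  -- In this form the sum over i needs only Σ x_i² = 1: the coefficient of tS is -d - 2 + 3 =
  -- -(d-1), that of t²γ is -2 + 1 = -1.
  have key : ∀ i, -x i * evalPoly (t • x, t) (sphericalDeriv t i P) +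
      evalPoly (t • x, t) (sphericalDeriv t i (sphericalDeriv t i P)) =
      t ^ 2 * b i i - t * S - 2 * t * (x i * a i) - 2 * t ^ 2 * (x i * β i) +
        (3 * t * S + t ^ 2 * γ) * x i ^ 2 := fun i => by
    have h1 : ∑ j, x j * evalPoly (t • x, t) (pderiv (some j) (sphericalDeriv t i P)) =
        t * β i - x i * S - x i * S - t * x i * γ := by
      have : ∀ j, x j * evalPoly (t • x, t) (pderiv (some j) (sphericalDeriv t i P)) =
          t * (x j * b j i) - (if j = i then x j * S else 0) - x i * (x j * a j) -
            t * x i * (x j * β j) := fun j => by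
        rw [evalPoly_pderiv_sphericalDeriv ht]
        split_ifs <;> simp only [ha, hb, hS, hβ] <;> ring
      simp only [this, Finset.sum_sub_distrib, ← Finset.mul_sum, Finset.sum_ite_eq',
        Finset.mem_univ, if_true]
      rfl
    have h2 : evalPoly (t • x, t) (pderiv (some i) (sphericalDeriv t i P)) =
        t * b i i - S - x i * a i - t * x i * β i := by
      rw [evalPoly_pderiv_sphericalDeriv ht, if_pos rfl, one_mul]
    rw [evalPoly_sphericalDeriv ht (sphericalDeriv t i P), evalPoly_sphericalDeriv ht P, h1, h2]
    change -x i * (t * a i - t * x i * S) + _ = _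
    ring
  rw [Finset.sum_congr rfl fun i _ => key i]
  simp only [Finset.sum_add_distrib, Finset.sum_sub_distrib, ← Finset.mul_sum, hsq,
    Finset.sum_const, Finset.card_univ, Fintype.card_fin, nsmul_eq_mul]
  rw [← hS, ← hγ]
  ring

theorem polar_mk (P : Poly d) (ξ : Sph d) (t : ℝ) :
    polar (Ideal.Quotient.mk (Ideal.span {conePoly d}) P) ξ t = evalPoly (t • (ξ : E d), t) P :=
  rfl

/-- With ξ fixed, the t-derivative is ∂_t + ξ·∇_x. The term t(ξ·∇_x)² of its square and the term
(d-1)ξ·∇_x cancel against the radial terms of t⁻¹Δ₀; the mixed term is 2 Σ x_i∂_i∂_t because x = tξ.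
-/
theorem diffOp_polar_mk {t : ℝ} (ht : 0 < t) (P : Poly d) (ξ : Sph d) :
    diffOp (polar (Ideal.Quotient.mk (Ideal.span {conePoly d}) P)) ξ t =
      evalPoly (t • (ξ : E d), t) (polyOp P) := by
  have h1 : ∀ Q : Poly d, deriv (fun s => evalPoly (s • (ξ : E d), s) Q) = fun s =>
      evalPoly (s • (ξ : E d), s) (pderiv none Q + ∑ i, C ((ξ : E d) i) * pderiv (some i) Q) :=
    fun Q => funext fun s => (hasDerivAt_evalPoly_ray (ξ : E d) Q s).deriv
  have h2 : polar (Ideal.Quotient.mk (Ideal.span {conePoly d}) P) ξ =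
      fun s => evalPoly (s • (ξ : E d), s) P := rfl
  have h3 : (fun η => polar (Ideal.Quotient.mk (Ideal.span {conePoly d}) P) η t) =
      fun η : Sph d => evalPoly (t • (η : E d), t) P := rfl
  rw [diffOp, h3, laplaceBeltrami_evalPoly ht, h2, iteratedDeriv_succ, iteratedDeriv_one, h1, h1]
  simp only [polyOp, euler, map_add, map_sub, map_mul, map_sum, map_natCast, map_one, map_ofNat,
    pderiv_mul, pderiv_C, zero_mul, zero_add, evalPoly_C, evalPoly_X_some, evalPoly_X_none,
    PiLp.smul_apply, smul_eq_mul, mul_add, Finset.sum_add_distrib,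
    pderiv_pderiv_comm none (some _) P, mul_assoc, ← Finset.mul_sum]
  have e : ∑ i, (ξ : E d) i * ∑ j, (ξ : E d) j *
      evalPoly (t • (ξ : E d), t) (pderiv (some j) (pderiv (some i) P)) =
      ∑ i, (ξ : E d) i * ∑ j, (ξ : E d) j *
      evalPoly (t • (ξ : E d), t) (pderiv (some i) (pderiv (some j) P)) := by
    simp only [pderiv_pderiv_comm (some _) (some _) P]
  field_simp
  linear_combination -t * e

/-! ### The inner product -/

theorem continuous_polarPoint : Continuous (polarPoint (d := d)) := by
  refine Continuous.subtype_mk ?_ _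
  fun_prop

theorem onSurface_mk (P : Poly d) (p : coneSurface d) :
    onSurface (Ideal.Quotient.mk (Ideal.span {conePoly d}) P) p = evalPoly p.1 P :=
  rfl

theorem integral_surface (hd : 2 ≤ d) (P : Poly d) :
    ∫ p, evalPoly p.1 P * laguerreWeight (-1) p.1.2 ∂(surfaceMeasure d) = coneIntegral hd P := by
  have hm : Measurable fun p : coneSurface d => evalPoly p.1 P * laguerreWeight (-1) p.1.2 := by
    refine ((continuous_evalPoly P).comp continuous_subtype_val).measurable.mul ?_
    unfold laguerreWeight
    fun_prop
  rw [surfaceMeasure, integral_map continuous_polarPoint.measurable.aemeasurable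
    hm.aestronglyMeasurable]
  rfl

theorem innerCone_mk (hd : 2 ≤ d) (P Q : Poly d) :
    innerCone (-1) (Ideal.Quotient.mk (Ideal.span {conePoly d}) P)
      (Ideal.Quotient.mk (Ideal.span {conePoly d}) Q) =
      normConst d (-1) * coneIntegral hd (P * Q) := by
  rw [← integral_surface hd, innerCone]
  simp only [onSurface_mk, map_mul]

/-- The total mass is Γ(d-1) times the area of the sphere. Hence the constant can be divided out of
the orthogonality relations. -/
theorem normConst_ne_zero (hd : 2 ≤ d) : normConst d (-1) ≠ 0 := by
  have h := integral_surface hd (1 : Poly d)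
  simp only [map_one, one_mul] at h
  rw [normConst, h, coneIntegral_of_isHomogeneous hd (isHomogeneous_one _ _)]
  have h1 := Real.Gamma_pos_of_pos (exponent_pos hd 0)
  have h2 : 0 < sphereIntegral (1 : Poly d) := by
    have : 0 < (volume : Measure (E d)).real (ball 0 1) :=
      ENNReal.toReal_pos (isOpen_ball.measure_pos _ (nonempty_ball.2 one_pos)).ne'
        measure_ball_lt_top.ne
    simp only [sphereIntegral, map_one, integral_const, smul_eq_mul, mul_one,
      Measure.toSphere_real_apply_univ, finrank_euclideanSpace, Fintype.card_fin]
    positivity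
  positivity

/-! ### Definiteness and the eigenvalue equation -/

/-- The projection (x,t) ↦ x carries t^{d-1}dσ(ξ)dt to Lebesgue measure, so definiteness follows
from the fact that continuous functions equal almost everywhere on ℝ^d are equal. -/
theorem coneIntegral_eq_integral (hd : 2 ≤ d) (P : Poly d) :
    coneIntegral hd P = ∫ x : E d, evalPoly (x, ‖x‖) P * laguerreWeight (-1) ‖x‖ := by
  have : NeZero d := ⟨by omega⟩
  rw [integral_eq_integral_polar]
  refine integral_congr_ae (.of_forall fun q => ?_)
  have hq : ‖(q.2 : ℝ) • (q.1 : E d)‖ = q.2 := by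
    simp [norm_smul, abs_of_pos (show (0 : ℝ) < q.2 from q.2.2)]
  simp only [hq]

theorem integrable_evalPoly_norm (hd : 2 ≤ d) (P : Poly d) :
    Integrable fun x : E d => evalPoly (x, ‖x‖) P * laguerreWeight (-1) ‖x‖ := by
  have : NeZero d := ⟨by omega⟩
  rw [integrable_iff_integrable_polar]
  refine (integrable_polar hd P).congr (.of_forall fun q => ?_)
  have hq : ‖(q.2 : ℝ) • (q.1 : E d)‖ = q.2 := by
    simp [norm_smul, abs_of_pos (show (0 : ℝ) < q.2 from q.2.2)]
  simp only [hq]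

/-- The inner product is definite on the functions on the surface of the cone. -/
theorem evalPoly_eq_zero_of_coneIntegral (hd : 2 ≤ d) {W : Poly d}
    (h : coneIntegral hd (W * W) = 0) (x : E d) : evalPoly (x, ‖x‖) W = 0 := by
  have : NeZero d := ⟨by omega⟩
  have hpos : ∀ x : E d, 0 ≤ laguerreWeight (-1) ‖x‖ := fun x => by
    unfold laguerreWeight
    positivity
  rw [coneIntegral_eq_integral, integral_eq_zero_iff_of_nonneg (fun x => by
    simp only [map_mul]
    exact mul_nonneg (mul_self_nonneg _) (hpos x)) (integrable_evalPoly_norm hd _)] at h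
  have hc : Continuous fun x : E d => evalPoly (x, ‖x‖) W :=
    (continuous_evalPoly W).comp (by fun_prop)
  have hae : (fun x : E d => evalPoly (x, ‖x‖) W) =ᵐ[volume] fun _ => 0 := by
    have hne : ∀ᵐ x : E d, x ≠ 0 := compl_mem_ae_iff.2 (measure_singleton _)
    filter_upwards [h, hne] with x hx hx0
    have hw : laguerreWeight (-1) ‖x‖ ≠ 0 := by
      have := norm_pos_iff.2 hx0
      unfold laguerreWeight
      positivity
    simpa [hw] using hx
  exact congrFun ((hc.ae_eq_iff_eq volume continuous_const).1 hae) x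

theorem totalDegree_le_of_mem_degLT {n : ℕ} {P : Poly d} (hP : P ∈ degLT d (n + 1)) :
    P.totalDegree ≤ n :=
  Finset.sup_le fun s hs => Nat.lt_succ_iff.1 (mem_degLT.1 hP s hs)

theorem mk_mem_polyDegLE {n : ℕ} {P : Poly d} (hP : P ∈ degLT d (n + 1)) :
    Ideal.Quotient.mk (Ideal.span {conePoly d}) P ∈ polyDegLE d n :=
  ⟨P, totalDegree_le_of_mem_degLT hP, rfl⟩

theorem evalPoly_polyOp_add_eq_zero (hd : 2 ≤ d) {n : ℕ} {P : Poly d} (hP : P.totalDegree ≤ n)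
    (horth : ∀ m < n, ∀ q ∈ polyDegLE d m,
      innerCone (-1) (Ideal.Quotient.mk (Ideal.span {conePoly d}) P) q = 0) (x : E d) :
    evalPoly (x, ‖x‖) (polyOp P + (n : Poly d) * P) = 0 := by
  have hW := polyOp_add_mem_degLT hP
  set W := polyOp P + (n : Poly d) * P with hWdef
  have hJ : ∀ Q ∈ degLT d n, coneIntegral hd (P * Q) = 0 := fun Q hQ => by
    -- For n = 0 there are no orthogonality relations, but a polynomial of degree less than 0 is
    -- zero.
    rcases n with _ | n
    · have : Q = 0 := by
        by_contra h0
        obtain ⟨s, hs⟩ := support_nonempty.2 h0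
        exact absurd (mem_degLT.1 hQ s hs) (by omega)
      rw [this, mul_zero, map_zero]
    · have := horth n (by omega) _ (mk_mem_polyDegLE hQ)
      rw [innerCone_mk hd] at this
      exact (mul_eq_zero.1 this).resolve_left (normConst_ne_zero hd)
  -- The degree bound is reused for W itself: its degree is already less than n, and the operator
  -- does not raise it.
  have hLW : polyOp W + (n : Poly d) * W ∈ degLT d n := by
    rcases n with _ | n
    · exact polyOp_add_mem_degLT (by
        have : W = 0 := by
          by_contra h0
          obtain ⟨s, hs⟩ := support_nonempty.2 h0
          exact absurd (mem_degLT.1 hW s hs) (by omega)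
        simp [this])
    · exact polyOp_add_mem_degLT ((totalDegree_le_of_mem_degLT hW).trans n.le_succ)
  refine evalPoly_eq_zero_of_coneIntegral hd ?_ x
  -- One factor W is expanded as L P + nP, and symmetry moves L from P to the other factor.
  have e : coneIntegral hd (W * W) = coneIntegral hd (P * (polyOp W + (n : Poly d) * W)) := by
    have hWW : W * W = W * polyOp P + (n : Poly d) * (P * W) := by
      nth_rw 2 [hWdef]
      ring
    rw [hWW, map_add, coneIntegral_mul_polyOp, ← map_add]
    congr 1
    ring
  rw [e, hJ _ hLW]

end

end ConeSurface


theorem mainTheorem9 (d : ℕ) (hd : 2 ≤ d) (n : ℕ)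
    (u : ConeSurface.ConeRing d) (hu : u ∈ ConeSurface.orthoPoly d (-1) n)
    (ξ : ConeSurface.Sph d) (t : ℝ) (ht : 0 < t) :
    ConeSurface.diffOp (ConeSurface.polar u) ξ t = -(n : ℝ) * ConeSurface.polar u ξ t := by
  obtain ⟨⟨P, hP, rfl⟩, horth⟩ := hu
  have h := ConeSurface.evalPoly_polyOp_add_eq_zero hd hP horth (t • (ξ : ConeSurface.E d))
  have hn : ‖t • (ξ : ConeSurface.E d)‖ = t := by simp [norm_smul, abs_of_pos ht]
  rw [hn, map_add, map_mul, map_natCast] at h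
  rw [ConeSurface.diffOp_polar_mk ht, ConeSurface.polar_mk]
  linear_combination h
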